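/- **Base score for $n$-spheres.** Let $n\ge 1$ be an integer, let $\mathcal S^n=\{x\in\mathbb R^{n+1}:\|x\|=1\}$ with $\|\cdot\|$ the Euclidean norm, and let $\mu$ be the normalised spherical (surface) measure on $\mathcal S^n$, a probability measure. For $\sigma>0$ put $$N_\sigma(v)=\frac{1}{(2\pi\sigma^2)^{(n+1)/2}}\exp\Big(-\frac{\|v\|^2}{2\sigma^2}\Big),\qquad v\in\mathbb R^{n+1},$$ and define the base score of $\mu$ at noise level $\sigma$ by $$s^{base}(x)=\nabla_x\log\int_{\mathcal S^n}N_\sigma(x-x_0)\,\mu(dx_0).$$ For real $\nu$ and $z>0$ let $$I_\nu(z)=\sum_{m=0}^\infty\frac{1}{m!\,\Gamma(m+\nu+1)}\Big(\frac z2\Big)^{2m+\nu}$$ be the modified Bessel function of the first kind of order $\nu$ (with $1/\Gamma=0$ at the poles of $\Gamma$). Then for every $\sigma>0$ and every $x\in\mathbb R^{n+1}$ with $x\ne 0$, the function $y\mapsto\log\int_{\mathcal S^n}N_\sigma(y-x_0)\,\mu(dx_0)$ is differentiable at $x$ and $$s^{base}(x)=-\frac{x}{\sigma^2}+\frac{1-n}{2}\,\frac{x}{\|x\|^2}+\frac{1}{2\,I_{\frac{n-1}{2}}\big(\frac{\|x\|}{\sigma^2}\big)}\Big(I_{\frac{n-3}{2}}\Big(\frac{\|x\|}{\sigma^2}\Big)+I_{\frac{n+1}{2}}\Big(\frac{\|x\|}{\sigma^2}\Big)\Big)\frac{x}{\sigma^2\|x\|}.$$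 -/

import Mathlib

noncomputable section

/-- The modified Bessel function of the first kind of real order `ν`, at an argument `z > 0`:
`I_ν(z) = ∑_{m ≥ 0} (z/2)^(2m+ν) / (m! Γ(m+ν+1))`.
If `m + ν + 1` is a pole of `Γ`, the term is zero (`1/Γ = 0` at the poles): Mathlib sets `Γ` to `0`
at its poles and `a / 0 = 0`. Hence negative integer orders are included, `I_{-k} = I_k`. -/
def besselI (ν z : ℝ) : ℝ :=
  ∑' m : ℕ, (z / 2) ^ (2 * (m : ℝ) + ν) / ((m.factorial : ℝ) * Real.Gamma ((m : ℝ) + ν + 1))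

/-- The isotropic centred Gaussian density on `ℝ^d` with variance `σ²`. -/
def gaussianKernel {d : ℕ} (σ : ℝ) (v : EuclideanSpace ℝ (Fin d)) : ℝ :=
  1 / (2 * Real.pi * σ ^ 2) ^ ((d : ℝ) / 2) * Real.exp (-‖v‖ ^ 2 / (2 * σ ^ 2))

/-- The density at `x` of the law `μ` on `ℝ^d` perturbed by Gaussian noise of variance `σ²`. -/
def noisedDensity {d : ℕ} (μ : MeasureTheory.Measure (EuclideanSpace ℝ (Fin d)))
    (σ : ℝ) (x : EuclideanSpace ℝ (Fin d)) : ℝ :=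
  ∫ x₀, gaussianKernel σ (x - x₀) ∂μ

/-- The base score of the base measure `μ`: the gradient of the log-density of the noised `μ`. -/
def baseScore {d : ℕ} (μ : MeasureTheory.Measure (EuclideanSpace ℝ (Fin d)))
    (σ : ℝ) (x : EuclideanSpace ℝ (Fin d)) : EuclideanSpace ℝ (Fin d) :=
  gradient (fun y => Real.log (noisedDensity μ σ y)) x

/-- The normalised surface measure on the unit sphere of `ℝ^(n+1)`. -/
def normalizedSphereMeasure (n : ℕ) :
    MeasureTheory.Measure (Metric.sphere (0 : EuclideanSpace ℝ (Fin (n + 1))) 1) :=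
  ((MeasureTheory.volume : MeasureTheory.Measure (EuclideanSpace ℝ (Fin (n + 1)))).toSphere Set.univ)⁻¹ •
    (MeasureTheory.volume : MeasureTheory.Measure (EuclideanSpace ℝ (Fin (n + 1)))).toSphere

/-- The normalised surface measure of the unit sphere, as a measure on `ℝ^(n+1)` supported
on the sphere. -/
def sphericalMeasure (n : ℕ) : MeasureTheory.Measure (EuclideanSpace ℝ (Fin (n + 1))) :=
  (normalizedSphereMeasure n).map Subtype.val

end

/-! On the sphere `‖x - ω‖² = ‖x‖² + 1 - 2⟪x, ω⟫`, so the noised density is a constant times `exp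
(-‖x‖² / (2σ²))` times the Laplace transform of surface measure at `x / σ²`. Expanding the
exponential reduces that transform to moments of a linear form: odd ones vanish by symmetry, and
even ones follow from computing one Gaussian integral both in polar and in Cartesian coordinates.
The result is `G_ν(‖x‖² / (4σ⁴))` with `ν = (n - 1) / 2` and `G_ν` = `besselSeries ν`
(`integral_exp_inner_toSphere`).

Since `G_ν' = G_{ν+1}` (`hasDerivAt_besselSeries`), the score is `-x/σ² + (I_{ν+1}/I_ν)(z)
x/(σ²‖x‖)` with `z = ‖x‖/σ²`. The recurrence `besselI_sub_one` replaces the ratio by `(I_{ν-1} +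
I_{ν+1}) / (2 I_ν) - ν/z`, and `-ν/z` yields the `(1 - n)/2` term. -/

open MeasureTheory Set
open scoped RealInnerProductSpace

/-! ### Moments of linear forms on the sphere -/

section SphereMoments

/-- The radial part of a Gaussian moment in polar coordinates. -/
theorem integral_pow_mul_exp_neg_sq_volumeIoiPow (N k : ℕ) :
    ∫ r : Ioi (0 : ℝ), (r : ℝ) ^ k * Real.exp (-(r : ℝ) ^ 2) ∂Measure.volumeIoiPow N =
      Real.Gamma (((k : ℝ) + (N + 1)) / 2) / 2 := by
  simp only [Measure.volumeIoiPow, ENNReal.ofReal]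
  rw [integral_withDensity_eq_integral_smul (measurable_subtype_coe.pow_const _).real_toNNReal,
    integral_subtype_comap measurableSet_Ioi
      fun a ↦ Real.toNNReal (a ^ N) • (a ^ k * Real.exp (-a ^ 2))]
  have h := integral_rpow_mul_exp_neg_rpow (p := 2) (q := (k : ℝ) + N) two_pos
    (by have : (0 : ℝ) ≤ (k : ℝ) + N := by positivity
        linarith)
  rw [setIntegral_congr_fun (g := fun x : ℝ ↦ x ^ ((k : ℝ) + N) * Real.exp (-x ^ (2 : ℝ)))
    measurableSet_Ioi fun x hx ↦ ?_, h]
  · rw [add_assoc]; ring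
  · simp only [NNReal.smul_def, Real.coe_toNNReal _ (pow_nonneg (le_of_lt hx) N), smul_eq_mul]
    rw [← Nat.cast_add, Real.rpow_natCast, Real.rpow_two, pow_add]
    ring

variable {E : Type*} [NormedAddCommGroup E] [InnerProductSpace ℝ E] [MeasurableSpace E]
  [BorelSpace E] [FiniteDimensional ℝ E] [Nontrivial E]

/-- Gaussian moments in polar coordinates. -/
theorem integral_inner_pow_mul_exp_neg_sq_eq_toSphere (μ : Measure E) [μ.IsAddHaarMeasure]
    (u : E) (k : ℕ) :
    ∫ x, ⟪u, x⟫ ^ k * Real.exp (-‖x‖ ^ 2) ∂μ =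
      (∫ ω : Metric.sphere (0 : E) 1, ⟪u, (ω : E)⟫ ^ k ∂μ.toSphere) *
        (Real.Gamma (((k : ℝ) + Module.finrank ℝ E) / 2) / 2) := by
  have hd : ((Module.finrank ℝ E - 1 : ℕ) : ℝ) + 1 = Module.finrank ℝ E := by
    have : 0 < Module.finrank ℝ E := Module.finrank_pos
    exact_mod_cast Nat.sub_add_cancel this
  calc
    _ = ∫ x : ({(0)}ᶜ : Set E), ⟪u, x.1⟫ ^ k * Real.exp (-‖x.1‖ ^ 2) ∂(μ.comap (↑)) := by
      rw [integral_subtype_comap (measurableSet_singleton _).compl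
        fun x ↦ ⟪u, x⟫ ^ k * Real.exp (-‖x‖ ^ 2), restrict_compl_singleton]
    _ = ∫ p, ⟪u, (p.1 : E)⟫ ^ k * ((p.2 : ℝ) ^ k * Real.exp (-(p.2 : ℝ) ^ 2))
          ∂μ.toSphere.prod (.volumeIoiPow (Module.finrank ℝ E - 1)) := by
      rw [← μ.measurePreserving_homeomorphUnitSphereProd.integral_comp
        (Homeomorph.measurableEmbedding _)]
      refine integral_congr_ae (.of_forall fun x ↦ ?_)
      have hx : ‖x.1‖ ≠ 0 := norm_ne_zero_iff.2 x.2
      simp only [homeomorphUnitSphereProd_apply_snd_coe, homeomorphUnitSphereProd_apply_fst_coe,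
        real_inner_smul_right]
      rw [← mul_assoc, ← mul_pow]
      congr 2
      field_simp
    _ = _ := by
      rw [integral_prod_mul (fun ω : Metric.sphere (0 : E) 1 ↦ ⟪u, (ω : E)⟫ ^ k)
        (fun r : Ioi (0 : ℝ) ↦ (r : ℝ) ^ k * Real.exp (-(r : ℝ) ^ 2)),
        integral_pow_mul_exp_neg_sq_volumeIoiPow, hd]

theorem integral_inner_pow_toSphere_of_odd (μ : Measure E) [μ.IsAddHaarMeasure]
    (u : E) {k : ℕ} (hk : Odd k) :
    ∫ ω : Metric.sphere (0 : E) 1, ⟪u, (ω : E)⟫ ^ k ∂μ.toSphere = 0 := by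
  have h := integral_inner_pow_mul_exp_neg_sq_eq_toSphere μ u k
  have h0 : ∫ x, ⟪u, x⟫ ^ k * Real.exp (-‖x‖ ^ 2) ∂μ = 0 := by
    have := integral_neg_eq_self (fun x ↦ ⟪u, x⟫ ^ k * Real.exp (-‖x‖ ^ 2)) μ
    simp only [inner_neg_right, norm_neg, hk.neg_pow, neg_mul, integral_neg] at this
    linarith
  rw [h0, eq_comm, mul_eq_zero] at h
  refine h.resolve_right (ne_of_gt (half_pos (Real.Gamma_pos_of_pos ?_)))
  have : 0 < Module.finrank ℝ E := Module.finrank_pos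
  positivity

theorem integral_even_pow_mul_exp_neg_sq (m : ℕ) :
    ∫ t : ℝ, t ^ (2 * m) * Real.exp (-t ^ 2) = Real.Gamma ((m : ℝ) + 1 / 2) := by
  have h := integral_comp_abs (f := fun t : ℝ ↦ t ^ (2 * m) * Real.exp (-t ^ 2))
  simp only [pow_mul, sq_abs] at h ⊢
  have h2 := integral_rpow_mul_exp_neg_rpow (p := 2) (q := 2 * (m : ℝ)) two_pos
    (by have : (0 : ℝ) ≤ 2 * m := by positivity
        linarith)
  rw [h, ← setIntegral_congr_fun (f := fun x : ℝ ↦ x ^ (2 * (m : ℝ)) * Real.exp (-x ^ (2 : ℝ)))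
    measurableSet_Ioi fun x hx ↦ ?_, h2]
  · rw [add_div, mul_div_cancel_left₀ _ two_ne_zero]; ring
  · have : 2 * (m : ℝ) = ((2 * m : ℕ) : ℝ) := by push_cast; ring
    simp only [this, Real.rpow_natCast, Real.rpow_two, pow_mul]

theorem integral_inner_even_pow_mul_exp_neg_sq {n : ℕ} (u : EuclideanSpace ℝ (Fin (n + 1)))
    (m : ℕ) :
    ∫ x, ⟪u, x⟫ ^ (2 * m) * Real.exp (-‖x‖ ^ 2) =
      ‖u‖ ^ (2 * m) * (Real.Gamma ((m : ℝ) + 1 / 2) * Real.Gamma (1 / 2) ^ n) := by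
  -- By rotation invariance `u` may be taken along the first axis, after which the integral factors
  -- over coordinates. For `u = 0` any unit vector serves.
  obtain ⟨e, he, hue⟩ : ∃ e : EuclideanSpace ℝ (Fin (n + 1)), ‖e‖ = 1 ∧ u = ‖u‖ • e := by
    by_cases hu : u = 0
    · exact ⟨EuclideanSpace.single 0 1, by simp, by simp [hu]⟩
    · exact ⟨‖u‖⁻¹ • u, norm_smul_inv_norm hu, by
        rw [smul_smul, mul_inv_cancel₀ (norm_ne_zero_iff.2 hu), one_smul]⟩
  obtain ⟨b, hb⟩ := Orthonormal.exists_orthonormalBasis_extension_of_card_eq (𝕜 := ℝ)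
    (E := EuclideanSpace ℝ (Fin (n + 1))) (ι := Fin (n + 1)) (by simp) (v := fun _ ↦ e)
    (s := {0}) ⟨fun _ ↦ he, fun i j hij ↦ absurd (Subsingleton.elim i j) hij⟩
  have hb0 : b 0 = e := hb 0 rfl
  calc
    _ = ∫ x, ‖u‖ ^ (2 * m) * (⟪e, x⟫ ^ (2 * m) * Real.exp (-‖x‖ ^ 2)) := by
      refine integral_congr_ae (.of_forall fun x ↦ ?_)
      dsimp only
      conv_lhs => rw [hue]
      rw [real_inner_smul_left, mul_pow]; ring
    _ = ‖u‖ ^ (2 * m) * ∫ x : EuclideanSpace ℝ (Fin (n + 1)),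
          (x 0) ^ (2 * m) * Real.exp (-‖x‖ ^ 2) := by
      rw [integral_const_mul, ← b.measurePreserving_repr.integral_comp
        b.repr.toHomeomorph.measurableEmbedding fun x ↦ (x 0) ^ (2 * m) * Real.exp (-‖x‖ ^ 2)]
      congr 1
      refine integral_congr_ae (.of_forall fun x ↦ ?_)
      simp [b.repr_apply_apply, hb0]
    _ = ‖u‖ ^ (2 * m) * ∫ x : Fin (n + 1) → ℝ,
          ∏ i, ((if i = 0 then x i ^ (2 * m) else 1) * Real.exp (-(x i) ^ 2)) := by
      rw [← (EuclideanSpace.volume_preserving_symm_measurableEquiv_toLp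
        (Fin (n + 1))).symm.integral_comp (MeasurableEquiv.measurableEmbedding _)]
      congr 1
      refine integral_congr_ae (.of_forall fun x ↦ ?_)
      dsimp only
      rw [Finset.prod_mul_distrib, ← Real.exp_sum, Finset.prod_ite_eq']
      simp [EuclideanSpace.norm_sq_eq]
    _ = _ := by
      rw [integral_fintype_prod_volume_eq_prod
        (f := fun i t ↦ (if i = 0 then t ^ (2 * m) else 1) * Real.exp (-t ^ 2)),
        Fin.prod_univ_succ]
      have h0 := integral_even_pow_mul_exp_neg_sq 0
      simp only [mul_zero, pow_zero, Nat.cast_zero, zero_add, one_mul] at h0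
      simp [integral_even_pow_mul_exp_neg_sq, h0, Fin.succ_ne_zero]

/-- The even moments of the linear form `⟪u, ·⟫` on the unit sphere. -/
theorem integral_inner_even_pow_toSphere {n : ℕ} (u : EuclideanSpace ℝ (Fin (n + 1))) (m : ℕ) :
    ∫ ω : Metric.sphere (0 : EuclideanSpace ℝ (Fin (n + 1))) 1,
        ⟪u, (ω : EuclideanSpace ℝ (Fin (n + 1)))⟫ ^ (2 * m) ∂volume.toSphere =
      2 * ‖u‖ ^ (2 * m) * (Real.Gamma ((m : ℝ) + 1 / 2) * Real.Gamma (1 / 2) ^ n) /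
        Real.Gamma ((m : ℝ) + ((n : ℝ) + 1) / 2) := by
  have h := integral_inner_pow_mul_exp_neg_sq_eq_toSphere volume u (2 * m)
  rw [integral_inner_even_pow_mul_exp_neg_sq, finrank_euclideanSpace_fin] at h
  have e : (((2 * m : ℕ) : ℝ) + ((n + 1 : ℕ) : ℝ)) / 2 = (m : ℝ) + ((n : ℝ) + 1) / 2 := by
    push_cast; ring
  rw [e] at h
  have : Real.Gamma ((m : ℝ) + ((n : ℝ) + 1) / 2) ≠ 0 :=
    (Real.Gamma_pos_of_pos (by positivity)).ne'
  field_simp at h ⊢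
  linarith

end SphereMoments

/-! ### Derivative and recurrence of the Bessel series -/

section BesselSeries

/-- The entire function `∑ wᵐ / (m! Γ(m + ν + 1))`, so that `I_ν(z) = (z/2)^ν G_ν(z²/4)`. -/
noncomputable def besselSeries (ν w : ℝ) : ℝ :=
  ∑' m : ℕ, w ^ m / ((m.factorial : ℝ) * Real.Gamma ((m : ℝ) + ν + 1))

/-- `Γ(s + 1) = s Γ(s) ≥ Γ(s)` for `s ≥ 1`. This lets the exponential series dominate the Bessel
series. -/
theorem Gamma_le_Gamma_nat_add {a : ℝ} (ha : 1 ≤ a) (m : ℕ) :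
    Real.Gamma a ≤ Real.Gamma ((m : ℝ) + a) := by
  induction m with
  | zero => simp
  | succ m ih =>
    have h1 : (1 : ℝ) ≤ m + a := by linarith [(Nat.cast_nonneg m : (0 : ℝ) ≤ m)]
    have h2 : ((m + 1 : ℕ) : ℝ) + a = (m + a) + 1 := by push_cast; ring
    rw [h2, Real.Gamma_add_one (by linarith)]
    have := Real.Gamma_pos_of_pos (by linarith : 0 < (m : ℝ) + a)
    nlinarith

theorem norm_besselSeries_term_le {ν R w : ℝ} (hν : 0 ≤ ν) (hw : |w| ≤ R) (m : ℕ) :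
    ‖w ^ m / ((m.factorial : ℝ) * Real.Gamma ((m : ℝ) + ν + 1))‖ ≤
      R ^ m / m.factorial / Real.Gamma (ν + 1) := by
  have h := Gamma_le_Gamma_nat_add (by linarith : 1 ≤ ν + 1) m
  rw [← add_assoc] at h
  have hpos := Real.Gamma_pos_of_pos (by linarith : 0 < ν + 1)
  have hpos' := hpos.trans_le h
  rw [norm_div, norm_pow, Real.norm_eq_abs, Real.norm_of_nonneg (by positivity), div_div]
  exact div_le_div₀ (pow_nonneg ((abs_nonneg w).trans hw) m) (pow_le_pow_left₀ (abs_nonneg w) hw m)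
    (by positivity) (by gcongr)

theorem summable_besselSeries {ν : ℝ} (hν : 0 ≤ ν) (w : ℝ) :
    Summable fun m : ℕ ↦ w ^ m / ((m.factorial : ℝ) * Real.Gamma ((m : ℝ) + ν + 1)) :=
  .of_norm_bounded ((Real.summable_pow_div_factorial |w|).div_const _)
    (norm_besselSeries_term_le hν le_rfl)

theorem hasSum_besselSeries {ν : ℝ} (hν : 0 ≤ ν) (w : ℝ) :
    HasSum (fun m : ℕ ↦ w ^ m / ((m.factorial : ℝ) * Real.Gamma ((m : ℝ) + ν + 1)))
      (besselSeries ν w) :=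
  (summable_besselSeries hν w).hasSum

theorem besselSeries_pos {ν w : ℝ} (hν : 0 ≤ ν) (hw : 0 ≤ w) : 0 < besselSeries ν w := by
  have h (m : ℕ) : 0 < Real.Gamma ((m : ℝ) + ν + 1) := Real.Gamma_pos_of_pos (by positivity)
  refine (summable_besselSeries hν w).tsum_pos
    (fun m ↦ div_nonneg (pow_nonneg hw m) (mul_nonneg (by positivity) (h m).le)) 0 ?_
  have := h 0
  simp only [pow_zero]
  positivity

theorem hasDerivAt_besselSeries {ν : ℝ} (hν : 0 ≤ ν) (w : ℝ) :
    HasDerivAt (besselSeries ν) (besselSeries (ν + 1) w) w := by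
  set R := |w| + 1
  set c : ℕ → ℝ := fun m ↦ (m.factorial : ℝ) * Real.Gamma ((m : ℝ) + ν + 1)
  have hshift (m : ℕ) (y : ℝ) : ((m + 1 : ℕ) : ℝ) * y ^ (m + 1 - 1) / c (m + 1) =
      y ^ m / ((m.factorial : ℝ) * Real.Gamma ((m : ℝ) + (ν + 1) + 1)) := by
    have : ((m + 1 : ℕ) : ℝ) ≠ 0 := by positivity
    simp only [c, Nat.factorial_succ, Nat.add_sub_cancel]
    rw [show ((m + 1 : ℕ) : ℝ) + ν + 1 = (m : ℝ) + (ν + 1) + 1 by push_cast; ring]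
    rw [Nat.cast_mul, mul_assoc, mul_div_mul_left _ _ this]
  -- Termwise differentiation on a ball containing `w`, where the derivatives have a uniform
  -- summable majorant.
  have key := hasDerivAt_tsum_of_isPreconnected (𝕜 := ℝ) (t := Metric.ball (0 : ℝ) R)
    (g := fun (m : ℕ) (y : ℝ) ↦ y ^ m / c m) (g' := fun (m : ℕ) (y : ℝ) ↦ (m : ℝ) * y ^ (m - 1) / c m)
    (u := fun m : ℕ ↦ (m : ℝ) * R ^ (m - 1) / (m.factorial : ℝ) / Real.Gamma (ν + 1))
    (y₀ := w) (y := w) ?_ Metric.isOpen_ball (convex_ball _ _).isPreconnected ?_ ?_ ?_ ?_ ?_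
  · have hs : Summable fun m : ℕ ↦ (m : ℝ) * w ^ (m - 1) / c m := by
      rw [← summable_nat_add_iff 1]
      simpa only [hshift] using summable_besselSeries (by linarith : 0 ≤ ν + 1) w
    have e : ∑' m : ℕ, (m : ℝ) * w ^ (m - 1) / c m = besselSeries (ν + 1) w := by
      rw [hs.tsum_eq_zero_add]
      simp only [hshift, besselSeries]
      simp
    rw [e] at key
    exact key
  · rw [← summable_nat_add_iff 1]
    refine ((Real.summable_pow_div_factorial R).div_const (Real.Gamma (ν + 1))).congr fun m ↦ ?_
    have : ((m + 1 : ℕ) : ℝ) ≠ 0 := by positivity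
    rw [Nat.factorial_succ, Nat.cast_mul, mul_div_mul_left _ _ this, Nat.add_sub_cancel]
  · exact fun m y _ ↦ (hasDerivAt_pow m y).div_const _
  · intro m y hy
    have hy' : |y| ≤ R := by simpa using (mem_ball_zero_iff.1 hy).le
    have h := Gamma_le_Gamma_nat_add (by linarith : 1 ≤ ν + 1) m
    rw [← add_assoc] at h
    have hpos := Real.Gamma_pos_of_pos (by linarith : 0 < ν + 1)
    have hpos' := hpos.trans_le h
    simp only [c]
    rw [norm_div, norm_mul, norm_pow, Real.norm_eq_abs y, Real.norm_of_nonneg (by positivity),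
      Real.norm_of_nonneg (by positivity), div_div]
    gcongr
  · simp [R]
  · exact summable_besselSeries hν w
  · simp [R]

/-- Unlike the functional equation of `Γ`, this form survives at `s = 0`, because `Γ 0 = 0` in
Mathlib. The case is needed for the circle, where `ν = 0` and the order `ν - 1` meets a pole. -/
theorem inv_Gamma_eq_mul_inv_Gamma_add_one (s : ℝ) :
    (Real.Gamma s)⁻¹ = s * (Real.Gamma (s + 1))⁻¹ := by
  rcases eq_or_ne s 0 with rfl | hs
  · simp [Real.Gamma_zero]
  · rw [Real.Gamma_add_one hs, mul_inv, mul_inv_cancel_left₀ hs]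

/-- Write `1/Γ(m + ν) = (m + ν)/Γ(m + ν + 1)`: the `m` part cancels into `m!` and shifts the index,
the `ν` part is `ν G_ν`. -/
theorem besselSeries_sub_one {ν : ℝ} (hν : 0 ≤ ν) (w : ℝ) :
    besselSeries (ν - 1) w = w * besselSeries (ν + 1) w + ν * besselSeries ν w := by
  set a : ℕ → ℝ := fun m ↦ m * (w ^ m / ((m.factorial : ℝ) * Real.Gamma ((m : ℝ) + ν + 1)))
  have ha (m : ℕ) : a (m + 1) =
      w * (w ^ m / ((m.factorial : ℝ) * Real.Gamma ((m : ℝ) + (ν + 1) + 1))) := by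
    have : ((m + 1 : ℕ) : ℝ) ≠ 0 := by positivity
    simp only [a, Nat.factorial_succ]
    rw [show ((m + 1 : ℕ) : ℝ) + ν + 1 = (m : ℝ) + (ν + 1) + 1 by push_cast; ring,
      Nat.cast_mul, ← mul_div_assoc, mul_assoc, mul_div_mul_left _ _ this, pow_succ']
    ring
  have h1 : HasSum a (w * besselSeries (ν + 1) w) := by
    rw [← hasSum_nat_add_iff' 1]
    simp only [ha]
    simpa [a] using (hasSum_besselSeries (by linarith : 0 ≤ ν + 1) w).mul_left w
  rw [← (h1.add ((hasSum_besselSeries hν w).mul_left ν)).tsum_eq, besselSeries]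
  refine tsum_congr fun m ↦ ?_
  simp only [a]
  rw [show (m : ℝ) + (ν - 1) + 1 = m + ν by ring, div_eq_mul_inv, mul_inv,
    inv_Gamma_eq_mul_inv_Gamma_add_one, div_eq_mul_inv, mul_inv]
  ring

theorem besselI_eq_rpow_mul_besselSeries (ν : ℝ) {z : ℝ} (hz : 0 < z) :
    besselI ν z = (z / 2) ^ ν * besselSeries ν ((z / 2) ^ 2) := by
  rw [besselI, besselSeries, ← tsum_mul_left]
  refine tsum_congr fun m ↦ ?_
  rw [Real.rpow_add (half_pos hz), show 2 * (m : ℝ) = ((2 * m : ℕ) : ℝ) by push_cast; ring,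
    Real.rpow_natCast, pow_mul]
  ring

theorem besselI_pos {ν z : ℝ} (hν : 0 ≤ ν) (hz : 0 < z) : 0 < besselI ν z := by
  rw [besselI_eq_rpow_mul_besselSeries ν hz]
  exact mul_pos (Real.rpow_pos_of_pos (half_pos hz) _) (besselSeries_pos hν (sq_nonneg _))

theorem besselI_add_one_div {ν z : ℝ} (hz : 0 < z) :
    besselI (ν + 1) z / besselI ν z =
      z / 2 * (besselSeries (ν + 1) ((z / 2) ^ 2) / besselSeries ν ((z / 2) ^ 2)) := by
  rw [besselI_eq_rpow_mul_besselSeries _ hz, besselI_eq_rpow_mul_besselSeries _ hz,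
    Real.rpow_add_one (half_pos hz).ne', mul_assoc,
    mul_div_mul_left _ _ (Real.rpow_pos_of_pos (half_pos hz) _).ne', mul_div_assoc]

/-- The recurrence `I_{ν-1}(z) = I_{ν+1}(z) + (2ν/z) I_ν(z)`. -/
theorem besselI_sub_one {ν z : ℝ} (hν : 0 ≤ ν) (hz : 0 < z) :
    besselI (ν - 1) z = besselI (ν + 1) z + 2 * ν / z * besselI ν z := by
  simp only [besselI_eq_rpow_mul_besselSeries _ hz]
  rw [besselSeries_sub_one hν, Real.rpow_sub_one (half_pos hz).ne',
    Real.rpow_add_one (half_pos hz).ne']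
  field_simp

end BesselSeries

/-! ### Laplace transform of the sphere and the noised density -/

section SphereLaplaceTransform

theorem hasSum_integral_inner_pow_toSphere {E : Type*} [NormedAddCommGroup E]
    [InnerProductSpace ℝ E] [MeasurableSpace E] [BorelSpace E] [FiniteDimensional ℝ E]
    (μ : Measure E) [μ.IsAddHaarMeasure] (y : E) :
    HasSum (fun k : ℕ ↦ (∫ ω : Metric.sphere (0 : E) 1, ⟪y, (ω : E)⟫ ^ k ∂μ.toSphere) /
        (k.factorial : ℝ))
      (∫ ω : Metric.sphere (0 : E) 1, Real.exp ⟪y, (ω : E)⟫ ∂μ.toSphere) := by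
  have h := hasSum_integral_of_dominated_convergence (μ := μ.toSphere)
    (F := fun (k : ℕ) (ω : Metric.sphere (0 : E) 1) ↦ ⟪y, (ω : E)⟫ ^ k / (k.factorial : ℝ))
    (f := fun ω ↦ Real.exp ⟪y, (ω : E)⟫) (fun k _ ↦ ‖y‖ ^ k / (k.factorial : ℝ))
    (fun k ↦ ?_) (fun k ↦ .of_forall fun ω ↦ ?_)
    (.of_forall fun _ ↦ Real.summable_pow_div_factorial _) (integrable_const _)
    (.of_forall fun ω ↦ ?_)
  · simpa only [integral_div] using h
  · exact Continuous.aestronglyMeasurable (by fun_prop)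
  · rw [norm_div, norm_pow, Real.norm_of_nonneg (Nat.cast_nonneg k.factorial)]
    gcongr
    simpa using norm_inner_le_norm (𝕜 := ℝ) y (ω : E)
  · rw [Real.exp_eq_exp_ℝ]
    exact NormedSpace.expSeries_div_hasSum_exp _

/-- Duplication formula at integers; it turns the `(2m)!` of the exponential series into the `4 ^ m
* m!` of the Bessel series. -/
theorem factorial_two_mul_mul_Gamma_half (m : ℕ) :
    ((2 * m).factorial : ℝ) * Real.Gamma (1 / 2) =
      4 ^ m * (m.factorial : ℝ) * Real.Gamma ((m : ℝ) + 1 / 2) := by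
  induction m with
  | zero => simp
  | succ m ih =>
    rw [show ((m + 1 : ℕ) : ℝ) + 1 / 2 = (m + 1 / 2) + 1 by push_cast; ring,
      Real.Gamma_add_one (by positivity), show 2 * (m + 1) = 2 * m + 1 + 1 by ring,
      Nat.factorial_succ, Nat.factorial_succ, Nat.factorial_succ]
    push_cast
    linear_combination (2 * (m : ℝ) + 1 + 1) * (2 * m + 1) * ih

/-- The Laplace transform of the surface measure of the unit sphere. -/
theorem integral_exp_inner_toSphere {n : ℕ} (y : EuclideanSpace ℝ (Fin (n + 1))) :
    ∫ ω : Metric.sphere (0 : EuclideanSpace ℝ (Fin (n + 1))) 1,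
        Real.exp ⟪y, (ω : EuclideanSpace ℝ (Fin (n + 1)))⟫ ∂volume.toSphere =
      2 * Real.Gamma (1 / 2) ^ (n + 1) * besselSeries (((n : ℝ) - 1) / 2) (‖y‖ ^ 2 / 4) := by
  have h := hasSum_integral_inner_pow_toSphere volume y
  have hinj : Function.Injective fun m : ℕ ↦ 2 * m := fun a b hab ↦ by simpa using hab
  rw [← hinj.hasSum_iff] at h
  · rw [← h.tsum_eq, besselSeries, ← tsum_mul_left]
    refine tsum_congr fun m ↦ ?_
    simp only [Function.comp_apply]
    rw [integral_inner_even_pow_toSphere,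
      show (m : ℝ) + ((n : ℝ) - 1) / 2 + 1 = m + ((n : ℝ) + 1) / 2 by ring]
    have h1 : Real.Gamma ((m : ℝ) + ((n : ℝ) + 1) / 2) ≠ 0 :=
      (Real.Gamma_pos_of_pos (by positivity)).ne'
    have h2 := factorial_two_mul_mul_Gamma_half m
    have h3 : ((2 * m).factorial : ℝ) ≠ 0 := by positivity
    have h4 : (m.factorial : ℝ) ≠ 0 := by positivity
    rw [div_pow, ← pow_mul, pow_succ]
    generalize Real.Gamma ((m : ℝ) + 1 / 2) = g at h2 ⊢
    generalize Real.Gamma (1 / 2) = g₀ at h2 ⊢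
    field_simp
    linear_combination -(‖y‖ ^ (2 * m) * g₀ ^ n) * h2
  · intro k hk
    rw [Set.mem_range, not_exists] at hk
    have hodd : Odd k := by
      rw [← Nat.not_even_iff_odd]
      rintro ⟨m, hm⟩
      exact hk m (by omega)
    rw [integral_inner_pow_toSphere_of_odd volume y hodd, zero_div]

theorem integral_sphericalMeasure {n : ℕ} {f : EuclideanSpace ℝ (Fin (n + 1)) → ℝ}
    (hf : Continuous f) :
    ∫ x, f x ∂sphericalMeasure n =
      ((volume : Measure (EuclideanSpace ℝ (Fin (n + 1)))).toSphere.real univ)⁻¹ *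
        ∫ ω : Metric.sphere (0 : EuclideanSpace ℝ (Fin (n + 1))) 1, f ω ∂volume.toSphere := by
  rw [sphericalMeasure, integral_map measurable_subtype_coe.aemeasurable
    hf.aestronglyMeasurable, normalizedSphereMeasure, integral_smul_measure, ENNReal.toReal_inv,
    smul_eq_mul, Measure.real]

/-- The noised uniform law on the sphere has a radial density given by a Bessel series. -/
theorem exists_noisedDensity_sphericalMeasure_eq (n : ℕ) {σ : ℝ} (hσ : 0 < σ) :
    ∃ C : ℝ, 0 < C ∧ ∀ y, noisedDensity (sphericalMeasure n) σ y =
      C * (Real.exp (-‖y‖ ^ 2 / (2 * σ ^ 2)) *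
        besselSeries (((n : ℝ) - 1) / 2) (‖y‖ ^ 2 / (4 * σ ^ 4))) := by
  set T := (volume : Measure (EuclideanSpace ℝ (Fin (n + 1)))).toSphere
  have hT : 0 < T.real univ :=
    ENNReal.toReal_pos (Measure.measure_univ_ne_zero.2 (Measure.toSphere_ne_zero _))
      (measure_ne_top _ _)
  have hG : 0 < Real.Gamma (1 / 2) := Real.Gamma_pos_of_pos (by norm_num)
  set A : ℝ := 1 / (2 * Real.pi * σ ^ 2) ^ (((n + 1 : ℕ) : ℝ) / 2)
  have hA : 0 < A := by positivity
  refine ⟨(T.real univ)⁻¹ * (A * Real.exp (-1 / (2 * σ ^ 2)) *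
    (2 * Real.Gamma (1 / 2) ^ (n + 1))), by positivity, fun y ↦ ?_⟩
  rw [noisedDensity, integral_sphericalMeasure (by unfold gaussianKernel; fun_prop)]
  have h (ω : Metric.sphere (0 : EuclideanSpace ℝ (Fin (n + 1))) 1) :
      gaussianKernel σ (y - (ω : EuclideanSpace ℝ (Fin (n + 1)))) = A * Real.exp (-1 / (2 * σ ^ 2)) *
        Real.exp (-‖y‖ ^ 2 / (2 * σ ^ 2)) *
        Real.exp ⟪(1 / σ ^ 2) • y, (ω : EuclideanSpace ℝ (Fin (n + 1)))⟫ := by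
    have hω : ‖(ω : EuclideanSpace ℝ (Fin (n + 1)))‖ = 1 := by simp
    rw [gaussianKernel, mul_assoc A, mul_assoc A, ← Real.exp_add, ← Real.exp_add,
      norm_sub_sq_real, hω, real_inner_smul_left]
    congr 2
    field_simp
    ring
  simp only [h]
  rw [integral_const_mul, integral_exp_inner_toSphere, norm_smul, mul_pow]
  rw [show ‖1 / σ ^ 2‖ ^ 2 * ‖y‖ ^ 2 / 4 = ‖y‖ ^ 2 / (4 * σ ^ 4) by
    rw [Real.norm_eq_abs, sq_abs]; field_simp]
  ring

theorem hasGradientAt_log_noisedDensity_sphericalMeasure {n : ℕ} (hn : 0 < n) {σ : ℝ}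
    (hσ : 0 < σ) (x : EuclideanSpace ℝ (Fin (n + 1))) :
    HasGradientAt (fun y ↦ Real.log (noisedDensity (sphericalMeasure n) σ y))
      ((-(1 / σ ^ 2) + besselSeries (((n : ℝ) - 1) / 2 + 1) (‖x‖ ^ 2 / (4 * σ ^ 4)) /
        besselSeries (((n : ℝ) - 1) / 2) (‖x‖ ^ 2 / (4 * σ ^ 4)) * (1 / (2 * σ ^ 4))) • x) x := by
  obtain ⟨C, hC, h⟩ := exists_noisedDensity_sphericalMeasure_eq n hσ
  set ν : ℝ := ((n : ℝ) - 1) / 2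
  have hν : 0 ≤ ν := by
    have : (1 : ℝ) ≤ n := by exact_mod_cast hn
    simp only [ν]; linarith
  have hpos (y : EuclideanSpace ℝ (Fin (n + 1))) :
      0 < besselSeries ν (‖y‖ ^ 2 / (4 * σ ^ 4)) := besselSeries_pos hν (by positivity)
  have hlog : (fun y ↦ Real.log (noisedDensity (sphericalMeasure n) σ y)) = fun y ↦
      Real.log C + (-‖y‖ ^ 2 / (2 * σ ^ 2) +
        Real.log (besselSeries ν (‖y‖ ^ 2 / (4 * σ ^ 4)))) := by
    funext y
    rw [h, Real.log_mul hC.ne' (mul_pos (Real.exp_pos _) (hpos y)).ne',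
      Real.log_mul (Real.exp_ne_zero _) (hpos y).ne', Real.log_exp]
  -- Differentiating in `s = ‖y‖²` avoids the singularity of the norm at the origin.
  have hr : HasDerivAt (fun s : ℝ ↦ Real.log C + (-s / (2 * σ ^ 2) +
      Real.log (besselSeries ν (s / (4 * σ ^ 4)))))
      (-1 / (2 * σ ^ 2) + besselSeries (ν + 1) (‖x‖ ^ 2 / (4 * σ ^ 4)) * (1 / (4 * σ ^ 4)) /
        besselSeries ν (‖x‖ ^ 2 / (4 * σ ^ 4))) (‖x‖ ^ 2) := by
    refine HasDerivAt.const_add _ (((hasDerivAt_id _).neg.div_const _).add (HasDerivAt.log ?_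
      (hpos x).ne'))
    exact (hasDerivAt_besselSeries hν _).comp (‖x‖ ^ 2) ((hasDerivAt_id _).div_const _)
  have hsq : HasFDerivAt (fun y : EuclideanSpace ℝ (Fin (n + 1)) ↦ ‖y‖ ^ 2)
      (2 • innerSL ℝ x) x := (hasStrictFDerivAt_norm_sq x).hasFDerivAt
  rw [hlog, hasGradientAt_iff_hasFDerivAt]
  refine (hr.comp_hasFDerivAt x hsq).congr_fderiv ?_
  ext v
  have := (hpos x).ne'
  simp
  field_simp
  ring

end SphereLaplaceTransform

theorem mainTheorem3 (n : ℕ) (hn : 0 < n) (σ : ℝ) (hσ : 0 < σ)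
    (x : EuclideanSpace ℝ (Fin (n + 1))) (hx : x ≠ 0) :
    DifferentiableAt ℝ (fun y => Real.log (noisedDensity (sphericalMeasure n) σ y)) x ∧
    baseScore (sphericalMeasure n) σ x =
      -((1 / σ ^ 2) • x)
      + ((1 - (n : ℝ)) / 2 * (1 / ‖x‖ ^ 2)) • x
      + ((1 / (2 * besselI (((n : ℝ) - 1) / 2) (‖x‖ / σ ^ 2))
          * (besselI (((n : ℝ) - 3) / 2) (‖x‖ / σ ^ 2)
            + besselI (((n : ℝ) + 1) / 2) (‖x‖ / σ ^ 2)))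
          * (1 / (σ ^ 2 * ‖x‖))) • x := by
  have hg := hasGradientAt_log_noisedDensity_sphericalMeasure hn hσ x
  refine ⟨hg.differentiableAt, ?_⟩
  rw [baseScore, hg.gradient]
  have hν : (0 : ℝ) ≤ ((n : ℝ) - 1) / 2 := by
    have : (1 : ℝ) ≤ n := by exact_mod_cast hn
    linarith
  have hx' : 0 < ‖x‖ := norm_pos_iff.2 hx
  have hz : 0 < ‖x‖ / σ ^ 2 := by positivity
  have hI := besselI_pos hν hz
  have hratio := besselI_add_one_div (ν := ((n : ℝ) - 1) / 2) hz
  have hw : (‖x‖ / σ ^ 2 / 2) ^ 2 = ‖x‖ ^ 2 / (4 * σ ^ 4) := by field_simp; norm_num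
  rw [hw] at hratio
  rw [show ((n : ℝ) - 3) / 2 = ((n : ℝ) - 1) / 2 - 1 by ring,
    show ((n : ℝ) + 1) / 2 = ((n : ℝ) - 1) / 2 + 1 by ring, besselI_sub_one hν hz,
    ← neg_smul, ← add_smul, ← add_smul]
  congr 1
  set q := besselSeries (((n : ℝ) - 1) / 2 + 1) (‖x‖ ^ 2 / (4 * σ ^ 4)) /
    besselSeries (((n : ℝ) - 1) / 2) (‖x‖ ^ 2 / (4 * σ ^ 4))
  rw [div_eq_iff hI.ne'] at hratio
  rw [hratio]
  field_simp
  ring
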